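/- Fix an infinite set $U$ from which all vertices are taken. For graphs $\Gamma\le K$, a $(K,\Gamma)$-design is a set $\mathcal B$ of subgraphs of $K$ (its blocks), each isomorphic to $\Gamma$, whose edge sets partition the edge set of $K$. A $\Gamma$-design of order $v$, or $(K_v,\Gamma)$-design, is such a design for $K$ a complete graph on some $v$-element subset of $U$. A down-link from a $\Gamma$-design $\mathcal B$ to a $\Gamma'$-design $\mathcal B'$ is a function $f:\mathcal B\to\mathcal B'$ such that $f(B)$ is a subgraph of $B$ for every $B\in\mathcal B$. Let $P_4$ be the path with $4$ vertices. Let $\mathcal L_1\Gamma(v)$ be the set of all $n$ such that some $\Gamma$-design of order $v$ has a down-link to some $P_4$-design of order $n$, and let $\mathcal L_2\Gamma(v)$ be the set of all $n$ such that every $\Gamma$-design of order $v$ has a down-link to some $P_4$-design of order $n$. Let $\Gamma$ be a graph containing a (not necessarily induced) subgraph isomorphic to $P_4$, and let $v>1$ be an integer such that a $(K_v,\Gamma)$-design exists. Then $$\{\,n\ge v+2 \;:\; n\equiv 0 \text{ or } 1 \pmod 3\,\}\subseteq \mathcal L_2\Gamma(v)\subseteq \mathcal L_1\Gamma(v).$$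 -/

import Mathlib

namespace PathDesign

variable {U : Type*} {W W' : Type*}

/-- A (simple) graph whose vertices are taken from the universe `U`: a set of vertices
together with a set of edges between them.
For `G H : GraphOn U`, `G ≤ H` means that `G` is a (not necessarily induced) subgraph of `H`. -/
abbrev GraphOn (U : Type*) : Type _ := (⊤ : SimpleGraph U).Subgraph

/-- The complete graph with vertex set `X`. -/
def completeOn (X : Finset U) : GraphOn U :=
  (⊤ : GraphOn U).induce (X : Set U)

/-- `𝓑` is a `(K, Γ)`-design: a set of subgraphs of `K`, each isomorphic to `Γ`,
whose edge sets partition the edge set of `K`. -/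
structure IsDesign (K : GraphOn U) (Γ : SimpleGraph W) (𝓑 : Set (GraphOn U)) : Prop where
  le : ∀ B ∈ 𝓑, B ≤ K
  iso : ∀ B ∈ 𝓑, Nonempty (B.coe ≃g Γ)
  partition : ∀ e ∈ K.edgeSet, ∃! B : GraphOn U, B ∈ 𝓑 ∧ e ∈ B.edgeSet

/-- `𝓑` is a `Γ`-design of order `v`, that is, a `(K_v, Γ)`-design, where `K_v` is the complete
graph on some set of `v` vertices. -/
def IsDesignOfOrder (Γ : SimpleGraph W) (v : ℕ) (𝓑 : Set (GraphOn U)) : Prop :=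
  ∃ X : Finset U, X.card = v ∧ IsDesign (completeOn X) Γ 𝓑

/-- `f` is a down-link from `𝓑` to `𝓑'`: it sends each block to a subgraph of that block. -/
def IsDownLink {𝓑 𝓑' : Set (GraphOn U)} (f : 𝓑 → 𝓑') : Prop :=
  ∀ B : 𝓑, (f B : GraphOn U) ≤ (B : GraphOn U)

/-- `𝓑` can be down-linked to a `Γ'`-design of order `n`. -/
def CanDownLink (Γ' : SimpleGraph W') (n : ℕ) (𝓑 : Set (GraphOn U)) : Prop :=
  ∃ 𝓑' : Set (GraphOn U), IsDesignOfOrder Γ' n 𝓑' ∧ ∃ f : 𝓑 → 𝓑', IsDownLink f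

/-- The set `ℒ₁Γ(v)` with respect to `Γ'`: all `n` such that some `Γ`-design of order `v` can be
down-linked to a `Γ'`-design of order `n`. All vertices are taken from `U`, which is meant to be
infinite. -/
def L1 (U : Type*) (Γ' : SimpleGraph W') (Γ : SimpleGraph W) (v : ℕ) : Set ℕ :=
  {n | ∃ 𝓑 : Set (GraphOn U), IsDesignOfOrder Γ v 𝓑 ∧ CanDownLink Γ' n 𝓑}

/-- The set `ℒ₂Γ(v)` with respect to `Γ'`: all `n` such that every `Γ`-design of order `v` can be
down-linked to a `Γ'`-design of order `n`. All vertices are taken from `U`, which is meant to be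
infinite. -/
def L2 (U : Type*) (Γ' : SimpleGraph W') (Γ : SimpleGraph W) (v : ℕ) : Set ℕ :=
  {n | ∀ 𝓑 : Set (GraphOn U), IsDesignOfOrder Γ v 𝓑 → CanDownLink Γ' n 𝓑}

/-- The path `P_k` on `k` vertices (with `k - 1` edges). -/
abbrev P (k : ℕ) : SimpleGraph (Fin k) := SimpleGraph.pathGraph k

end PathDesign

namespace PathDesign

open Finset

variable {U : Type*}

/-! Pick a `P 4` inside each block of the given design on `X`. Blocks share no edge, so neither do
these paths, and it suffices to extend them to a `P 4`-design of order `n`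
(`exists_design_of_edge_disjoint`). Enlarge `X` to a set `Z` of `n - 2` vertices, let `E` be the
edges on `Z` that no chosen path uses, and add two new vertices `a`, `b`. What remains to be
decomposed is the join of the graph `(Z, E)` with the edge `ab`. Its number of edges is divisible by
3, because that of `K_n` is.

The heart is `pathDecomposable_joinEdges`: divisibility by 3 suffices for any graph `E` on at least
two vertices. Paths inside `E` are split off while they exist; afterwards every component is a
triangle or a star. A triangle, or two pendant edges, is then removed together with all edges from
`a` and `b` to its three vertices, respectively to the two leaves; these edges form paths. Once `E`
has at most one edge, isolated vertices are removed in threes. A removal is forbidden only if a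
single vertex `w` would be left, since the triangle `abw` has no decomposition; such small cases are
decomposed by hand.

Multisets turn the bookkeeping into identities for `abel`; disjointness is recovered at the end from
`joinEdges_nodup`. -/

/-- A multiset of edges that is a sum of edge sets of paths with four vertices. -/
inductive PathDecomposable : Multiset (Sym2 U) → Prop
  | zero : PathDecomposable 0
  | add_path {M : Multiset (Sym2 U)} (p q r t : U) (hpath : [p, q, r, t].Nodup)
      (hM : PathDecomposable M) :
      PathDecomposable (M + {s(p, q)} + {s(q, r)} + {s(r, t)})

theorem PathDecomposable.of_eq {M N : Multiset (Sym2 U)} (p q r t : U)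
    (hpath : [p, q, r, t].Nodup) (hM : PathDecomposable M)
    (h : N = M + {s(p, q)} + {s(q, r)} + {s(r, t)}) : PathDecomposable N :=
  h ▸ .add_path p q r t hpath hM

/-- The edges `E`, the edges joining `a` and `b` to all vertices in `X`, and the edge `ab`. -/
def joinEdges (a b : U) (X : Finset U) (E : Finset (Sym2 U)) : Multiset (Sym2 U) :=
  E.val + X.val.map (fun x => s(a, x)) + X.val.map (fun x => s(b, x)) + {s(a, b)}

theorem joinEdges_empty {a b : U} : joinEdges a b ∅ ∅ = {s(a, b)} := by
  simp [joinEdges]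

/-- `E` is the edge set of a simple graph with vertices in `X`. -/
def IsGraphOn (X : Finset U) (E : Finset (Sym2 U)) : Prop :=
  ∀ e ∈ E, ¬ e.IsDiag ∧ ∀ u ∈ e, u ∈ X

theorem IsGraphOn.ne {X : Finset U} {E : Finset (Sym2 U)} (h : IsGraphOn X E)
    {x y : U} (hxy : s(x, y) ∈ E) : x ≠ y :=
  fun hne => (h _ hxy).1 (by simp [hne])

theorem IsGraphOn.eq_empty {X : Finset U} {E : Finset (Sym2 U)} (h : IsGraphOn X E)
    (hX : X.card ≤ 1) : E = ∅ := by
  refine eq_empty_of_forall_notMem fun e he => ?_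
  induction e with
  | _ x y =>
    exact h.ne he (card_le_one.1 hX x ((h _ he).2 x (by simp)) y ((h _ he).2 y (by simp)))

section

variable [DecidableEq U] {a b : U} {X : Finset U} {E : Finset (Sym2 U)}

theorem joinEdges_erase_vertex {y : U} (hy : y ∈ X) :
    joinEdges a b X E = joinEdges a b (X.erase y) E + {s(a, y)} + {s(b, y)} := by
  have h : X.val = (X.erase y).val + {y} := by
    rw [add_comm, Multiset.singleton_add, erase_val, Multiset.cons_erase hy]
  unfold joinEdges
  rw [h]
  simp only [Multiset.map_add, Multiset.map_singleton]
  abel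

theorem joinEdges_erase_edge {e : Sym2 U} (he : e ∈ E) :
    joinEdges a b X E = joinEdges a b X (E.erase e) + {e} := by
  have h : E.val = (E.erase e).val + {e} := by
    rw [add_comm, Multiset.singleton_add, erase_val, Multiset.cons_erase he]
  unfold joinEdges
  rw [h]
  abel

theorem IsGraphOn.erase_edge (h : IsGraphOn X E) (e : Sym2 U) : IsGraphOn X (E.erase e) :=
  fun f hf => h f (mem_of_mem_erase hf)

theorem IsGraphOn.erase_vertex (h : IsGraphOn X E) {y : U} (hy : ∀ e ∈ E, y ∉ e) :
    IsGraphOn (X.erase y) E :=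
  fun e he => ⟨(h e he).1, fun u hu =>
    mem_erase.2 ⟨fun huy => hy e he (huy ▸ hu), (h e he).2 u hu⟩⟩

theorem pathDecomposable_remove_path {p q r t : U} (hpath : [p, q, r, t].Nodup)
    (hpq : s(p, q) ∈ E) (hqr : s(q, r) ∈ E) (hrt : s(r, t) ∈ E)
    (h : PathDecomposable
      (joinEdges a b X (((E.erase s(p, q)).erase s(q, r)).erase s(r, t)))) :
    PathDecomposable (joinEdges a b X E) := by
  refine .of_eq p q r t hpath h ?_
  have h1 : s(q, r) ∈ E.erase s(p, q) := by
    refine mem_erase.2 ⟨?_, hqr⟩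
    simp at hpath ⊢; grind
  have h2 : s(r, t) ∈ (E.erase s(p, q)).erase s(q, r) := by
    refine mem_erase.2 ⟨?_, mem_erase.2 ⟨?_, hrt⟩⟩ <;> · simp at hpath ⊢; grind
  rw [joinEdges_erase_edge hpq, joinEdges_erase_edge h1, joinEdges_erase_edge h2]
  abel

theorem joinEdges_erase_three_edges {e f g : Sym2 U} (he : e ∈ E) (hf : f ∈ E) (hg : g ∈ E)
    (hef : e ≠ f) (heg : e ≠ g) (hfg : f ≠ g) :
    joinEdges a b X E =
      joinEdges a b X (((E.erase e).erase f).erase g) + {e} + {f} + {g} := by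
  rw [joinEdges_erase_edge he, joinEdges_erase_edge (mem_erase.2 ⟨hef.symm, hf⟩),
    joinEdges_erase_edge (mem_erase.2 ⟨hfg.symm, mem_erase.2 ⟨heg.symm, hg⟩⟩)]
  abel

theorem joinEdges_erase_three_vertices {x y z : U} (hx : x ∈ X) (hy : y ∈ X) (hz : z ∈ X)
    (hxy : x ≠ y) (hxz : x ≠ z) (hyz : y ≠ z) :
    joinEdges a b X E = joinEdges a b (((X.erase x).erase y).erase z) E
      + {s(a, x)} + {s(b, x)} + {s(a, y)} + {s(b, y)} + {s(a, z)} + {s(b, z)} := by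
  rw [joinEdges_erase_vertex hx, joinEdges_erase_vertex (mem_erase.2 ⟨hxy.symm, hy⟩),
    joinEdges_erase_vertex (mem_erase.2 ⟨hyz.symm, mem_erase.2 ⟨hxz.symm, hz⟩⟩)]
  abel


end

end PathDesign

/-! ### Explicit decompositions: reduction steps and small cases. -/

namespace PathDesign

open Finset

section

variable {U : Type*} [DecidableEq U] {a b : U} {X : Finset U} {E : Finset (Sym2 U)}

theorem pathDecomposable_remove_vertices (hab : a ≠ b) (ha : a ∉ X) (hb : b ∉ X) {x y z : U}
    (hx : x ∈ X) (hy : y ∈ X) (hz : z ∈ X) (hxy : x ≠ y) (hxz : x ≠ z) (hyz : y ≠ z)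
    (h : PathDecomposable (joinEdges a b (((X.erase x).erase y).erase z) E)) :
    PathDecomposable (joinEdges a b X E) := by
  rw [joinEdges_erase_three_vertices hx hy hz hxy hxz hyz]
  refine .of_eq x a y b (by simp; grind) (.add_path x b z a (by simp; grind) h) ?_
  rw [Sym2.eq_swap (a := x) (b := a), Sym2.eq_swap (a := x) (b := b),
    Sym2.eq_swap (a := y) (b := b), Sym2.eq_swap (a := z) (b := a)]
  abel

/-- The three paths `axyb`, `ayzb`, `azxb` arise from one another by rotating the triangle. -/
theorem pathDecomposable_remove_triangle (hab : a ≠ b) (ha : a ∉ X) (hb : b ∉ X) {x y z : U}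
    (hx : x ∈ X) (hy : y ∈ X) (hz : z ∈ X) (hxy : x ≠ y) (hxz : x ≠ z) (hyz : y ≠ z)
    (exy : s(x, y) ∈ E) (eyz : s(y, z) ∈ E) (exz : s(x, z) ∈ E)
    (h : PathDecomposable (joinEdges a b (((X.erase x).erase y).erase z)
      (((E.erase s(x, y)).erase s(y, z)).erase s(x, z)))) :
    PathDecomposable (joinEdges a b X E) := by
  rw [joinEdges_erase_three_vertices hx hy hz hxy hxz hyz,
    joinEdges_erase_three_edges exy eyz exz (by simp; grind) (by simp; grind) (by simp; grind)]
  refine .of_eq a x y b (by simp; grind) (.add_path a y z b (by simp; grind)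
    (.add_path a z x b (by simp; grind) h)) ?_
  rw [Sym2.eq_swap (a := x) (b := b), Sym2.eq_swap (a := y) (b := b),
    Sym2.eq_swap (a := z) (b := b), Sym2.eq_swap (a := z) (b := x)]
  abel

/-- Here removing the triangle would leave only `w`, so the edge `ab` has to be used along with it:
twelve edges, four paths. -/
theorem pathDecomposable_triangle_add_vertex (hab : a ≠ b) (ha : a ∉ X) (hb : b ∉ X)
    {x y z w : U} (hx : x ∈ X) (hy : y ∈ X) (hz : z ∈ X) (hxy : x ≠ y) (hxz : x ≠ z)
    (hyz : y ≠ z) (exy : s(x, y) ∈ E) (eyz : s(y, z) ∈ E) (exz : s(x, z) ∈ E)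
    (hX : ((X.erase x).erase y).erase z = {w})
    (hE : ((E.erase s(x, y)).erase s(y, z)).erase s(x, z) = ∅) :
    PathDecomposable (joinEdges a b X E) := by
  have hw : w ∈ ((X.erase x).erase y).erase z := by simp [hX]
  rw [joinEdges_erase_three_vertices hx hy hz hxy hxz hyz,
    joinEdges_erase_three_edges exy eyz exz (by simp; grind) (by simp; grind) (by simp; grind),
    hE, hX, joinEdges_erase_vertex (mem_singleton_self w), erase_singleton, joinEdges_empty]
  refine .of_eq w a x y (by simp; grind) (.add_path w b y z (by simp; grind)
    (.add_path a z x b (by simp; grind) (.add_path y a b z (by simp; grind) .zero))) ?_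
  rw [Sym2.eq_swap (a := w) (b := a), Sym2.eq_swap (a := w) (b := b),
    Sym2.eq_swap (a := z) (b := x), Sym2.eq_swap (a := x) (b := b), Sym2.eq_swap (a := y) (b := a)]
  abel

theorem joinEdges_erase_pendants {x y w z : U} (hy : y ∈ X) (hz : z ∈ X) (hyz : y ≠ z)
    (exy : s(x, y) ∈ E) (ewz : s(w, z) ∈ E) (hxz : x ≠ z) :
    joinEdges a b X E =
      joinEdges a b ((X.erase y).erase z) ((E.erase s(x, y)).erase s(w, z))
        + {s(a, y)} + {s(b, y)} + {s(a, z)} + {s(b, z)} + {s(x, y)} + {s(w, z)} := by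
  rw [joinEdges_erase_vertex hy, joinEdges_erase_vertex (mem_erase.2 ⟨hyz.symm, hz⟩),
    joinEdges_erase_edge exy,
    joinEdges_erase_edge (mem_erase.2 ⟨by simp; grind, ewz⟩)]
  abel

/-- Only the leaves `y` and `z` disappear. The centres `x` and `w` stay and may coincide. -/
theorem pathDecomposable_remove_pendants (ha : a ∉ X) (hb : b ∉ X)
    {x y w z : U} (hx : x ∈ X) (hy : y ∈ X) (hw : w ∈ X) (hz : z ∈ X)
    (hxy : x ≠ y) (hwz : w ≠ z) (hyz : y ≠ z) (hxz : x ≠ z) (hyw : y ≠ w)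
    (exy : s(x, y) ∈ E) (ewz : s(w, z) ∈ E)
    (h : PathDecomposable
      (joinEdges a b ((X.erase y).erase z) ((E.erase s(x, y)).erase s(w, z)))) :
    PathDecomposable (joinEdges a b X E) := by
  rw [joinEdges_erase_pendants hy hz hyz exy ewz hxz]
  refine .of_eq x y a z (by simp; grind) (.add_path y b z w (by simp; grind) h) ?_
  rw [Sym2.eq_swap (a := y) (b := a), Sym2.eq_swap (a := y) (b := b),
    Sym2.eq_swap (a := z) (b := w)]
  abel

/-- The exceptional case of removing two pendant edges: the common centre would be the only vertex
left. -/
theorem pathDecomposable_cherry (hab : a ≠ b) (ha : a ∉ X) (hb : b ∉ X)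
    {x y z : U} (hx : x ∈ X) (hy : y ∈ X) (hz : z ∈ X)
    (hxy : x ≠ y) (hyz : y ≠ z) (hxz : x ≠ z)
    (exy : s(x, y) ∈ E) (exz : s(x, z) ∈ E)
    (hX : (X.erase y).erase z = {x}) (hE : (E.erase s(x, y)).erase s(x, z) = ∅) :
    PathDecomposable (joinEdges a b X E) := by
  rw [joinEdges_erase_pendants hy hz hyz exy exz hxz, hX, hE,
    joinEdges_erase_vertex (mem_singleton_self x), erase_singleton, joinEdges_empty]
  refine .of_eq y x a z (by simp; grind) (.add_path y a b z (by simp; grind)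
    (.add_path y b x z (by simp; grind) .zero)) ?_
  rw [Sym2.eq_swap (a := y) (b := a), Sym2.eq_swap (a := y) (b := b),
    Sym2.eq_swap (a := y) (b := x), Sym2.eq_swap (a := x) (b := a)]
  abel

theorem pathDecomposable_edge (hab : a ≠ b) {x y : U} (hxy : x ≠ y)
    (ha : a ∉ ({x, y} : Finset U)) (hb : b ∉ ({x, y} : Finset U)) :
    PathDecomposable (joinEdges a b {x, y} {s(x, y)}) := by
  have h : joinEdges a b {x, y} {s(x, y)} = ({s(x, y)} : Multiset (Sym2 U)) +
      {s(a, x)} + {s(a, y)} + {s(b, x)} + {s(b, y)} + {s(a, b)} := by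
    simp only [joinEdges, singleton_val, insert_val_of_notMem (by simpa using hxy : x ∉ {y}),
      ← Multiset.singleton_add, Multiset.map_add, Multiset.map_singleton]
    abel
  simp only [mem_insert, mem_singleton] at ha hb
  rw [h]
  refine .of_eq x y a b (by simp; grind) (.add_path y b x a (by simp; grind) .zero) ?_
  rw [Sym2.eq_swap (a := y) (b := a), Sym2.eq_swap (a := y) (b := b),
    Sym2.eq_swap (a := x) (b := a)]
  abel

theorem pathDecomposable_four_vertices (hab : a ≠ b) (ha : a ∉ X) (hb : b ∉ X)
    (hX : X.card = 4) : PathDecomposable (joinEdges a b X ∅) := by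
  obtain ⟨w, x, hw, hcard⟩ : ∃ w x, w ∈ X ∧ x ∈ X.erase w := by
    obtain ⟨w, hw⟩ := card_pos.1 (by omega : 0 < X.card)
    obtain ⟨x, hx⟩ := card_pos.1 (by rw [card_erase_of_mem hw]; omega : 0 < (X.erase w).card)
    exact ⟨w, x, hw, hx⟩
  obtain ⟨y, z, hyz, h⟩ := card_eq_two.1
    (by rw [card_erase_of_mem hcard, card_erase_of_mem hw]; omega :
      ((X.erase w).erase x).card = 2)
  have hy : y ∈ (X.erase w).erase x := by simp [h]
  have hz : z ∈ (X.erase w).erase x := by simp [h]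
  have hz' : z ∈ ((X.erase w).erase x).erase y := mem_erase.2 ⟨hyz.symm, hz⟩
  have he : (((X.erase w).erase x).erase y).erase z = ∅ := by rw [h]; ext; simp; grind
  rw [joinEdges_erase_vertex hw, joinEdges_erase_vertex hcard, joinEdges_erase_vertex hy,
    joinEdges_erase_vertex hz', he, joinEdges_empty]
  simp only [mem_erase] at *
  refine .of_eq x a b y (by simp; grind) (.add_path x b z a (by simp; grind)
    (.add_path y a w b (by simp; grind) .zero)) ?_
  rw [Sym2.eq_swap (a := x) (b := a), Sym2.eq_swap (a := x) (b := b),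
    Sym2.eq_swap (a := z) (b := a), Sym2.eq_swap (a := y) (b := a), Sym2.eq_swap (a := w) (b := b)]
  abel

/-! ### Decomposing the join by induction. -/

/-- In a graph without a path on four vertices and without a triangle every edge is pendant. -/
theorem IsGraphOn.exists_pendant (h : IsGraphOn X E)
    (hP : ¬ ∃ p q r t, [p, q, r, t].Nodup ∧ s(p, q) ∈ E ∧ s(q, r) ∈ E ∧ s(r, t) ∈ E)
    (hT : ¬ ∃ x y z, x ≠ y ∧ x ≠ z ∧ y ≠ z ∧ s(x, y) ∈ E ∧ s(y, z) ∈ E ∧ s(x, z) ∈ E)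
    {e : Sym2 U} (he : e ∈ E) :
    ∃ x y, e = s(x, y) ∧ ∀ f ∈ E, y ∈ f → f = e := by
  induction e with
  | _ x y =>
    by_contra! hc
    obtain ⟨f, hf, hyf, hfe⟩ := hc x y rfl
    obtain ⟨g, hg, hxg, hge⟩ := hc y x Sym2.eq_swap
    obtain ⟨z, rfl⟩ := Sym2.mem_iff_exists.1 hyf
    obtain ⟨w, rfl⟩ := Sym2.mem_iff_exists.1 hxg
    have h1 := h.ne he
    have h2 := h.ne hf
    have h3 := h.ne hg
    have hzx : z ≠ x := by rintro rfl; exact hfe Sym2.eq_swap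
    have hwy : w ≠ y := by rintro rfl; exact hge rfl
    by_cases hwz : w = z
    · subst hwz
      exact hT ⟨x, y, w, h1, h3, h2, he, hf, hg⟩
    · refine hP ⟨w, x, y, z, by simp; grind, Sym2.eq_swap (a := x) ▸ hg, he, hf⟩

/-- Induction on the number of vertices, stripping three isolated ones at a time. -/
theorem pathDecomposable_joinEdges_of_card_le_one (hab : a ≠ b) (ha : a ∉ X) (hb : b ∉ X)
    (h : IsGraphOn X E) (hE : E.card ≤ 1) (hX : 2 ≤ X.card)
    (hdvd : 3 ∣ E.card + 2 * X.card + 1) : PathDecomposable (joinEdges a b X E) := by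
  induction hn : X.card using Nat.strong_induction_on generalizing X with
  | _ n ih =>
  subst hn
  -- Five vertices leave three off a possible edge, and two after those three are removed.
  by_cases hX5 : 5 ≤ X.card
  · obtain ⟨Y, hYX, hY, hYE⟩ : ∃ Y ⊆ X, Y.card = 3 ∧ ∀ e ∈ E, ∀ u ∈ Y, u ∉ e := by
      rcases E.eq_empty_or_nonempty with rfl | ⟨e, he⟩
      · obtain ⟨Y, hYX, hY⟩ := exists_subset_card_eq (by omega : 3 ≤ X.card)
        exact ⟨Y, hYX, hY, by simp⟩
      · obtain rfl : E = {e} := (card_eq_one.1 (le_antisymm hE (card_pos.2 ⟨e, he⟩))).elim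
          fun f hf => by subst hf; simp at he; simp [he]
        induction e with
        | _ x y =>
          have hc : 3 ≤ ((X.erase x).erase y).card := by
            have := pred_card_le_card_erase (s := X) (a := x)
            have := pred_card_le_card_erase (s := X.erase x) (a := y)
            omega
          obtain ⟨Y, hYX, hY⟩ := exists_subset_card_eq hc
          refine ⟨Y, hYX.trans ((erase_subset _ _).trans (erase_subset _ _)), hY, ?_⟩
          intro e he u hu
          have := hYX hu
          simp only [mem_singleton] at he
          subst he
          simp at this ⊢
          tauto
    obtain ⟨x, y, z, hxy, hxz, hyz, rfl⟩ := card_eq_three.1 hY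
    have hx := hYX (by simp : x ∈ _)
    have hy := hYX (by simp : y ∈ _)
    have hz := hYX (by simp : z ∈ _)
    have hcard : (((X.erase x).erase y).erase z).card = X.card - 3 := by
      rw [card_erase_of_mem (by simp; grind), card_erase_of_mem (by simp; grind),
        card_erase_of_mem hx]; omega
    refine pathDecomposable_remove_vertices hab ha hb hx hy hz hxy hxz hyz ?_
    refine ih _ (by omega) (by simp [ha]) (by simp [hb]) ?_ (by omega) (by omega) hcard
    exact ((h.erase_vertex fun e he => hYE e he x (by simp)).erase_vertex
      fun e he => hYE e he y (by simp)).erase_vertex fun e he => hYE e he z (by simp)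
  -- For 2 to 4 vertices, divisibility forces four vertices if there is no edge and two if there is
  -- one.
  · rcases E.eq_empty_or_nonempty with rfl | hne
    · exact pathDecomposable_four_vertices hab ha hb (by simp at hdvd; omega)
    · have hE1 : E.card = 1 := le_antisymm hE (card_pos.2 hne)
      obtain ⟨e, rfl⟩ := card_eq_one.1 hE1
      obtain ⟨x, y, hxy, rfl⟩ := card_eq_two.1 (by omega : X.card = 2)
      induction e with
      | _ u w =>
        have h1 := h.ne (mem_singleton_self _)
        have h2 := (h _ (mem_singleton_self _)).2 u (by simp)
        have h3 := (h _ (mem_singleton_self _)).2 w (by simp)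
        obtain h4 : s(u, w) = s(x, y) := by simp at h2 h3 ⊢; grind
        rw [h4]
        exact pathDecomposable_edge hab hxy ha hb

/-- The join of a graph with a complete graph on two vertices decomposes into paths on
four vertices, provided that the number of edges is divisible by three. -/
theorem pathDecomposable_joinEdges (hab : a ≠ b) (ha : a ∉ X) (hb : b ∉ X)
    (h : IsGraphOn X E) (hX : 2 ≤ X.card) (hdvd : 3 ∣ E.card + 2 * X.card + 1) :
    PathDecomposable (joinEdges a b X E) := by
  induction hn : E.card using Nat.strong_induction_on generalizing X E with
  | _ n ih =>
  subst hn
  by_cases hP : ∃ p q r t, [p, q, r, t].Nodup ∧ s(p, q) ∈ E ∧ s(q, r) ∈ E ∧ s(r, t) ∈ E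
  · obtain ⟨p, q, r, t, hnd, hpq, hqr, hrt⟩ := hP
    refine pathDecomposable_remove_path hnd hpq hqr hrt ?_
    have hcard : (((E.erase s(p, q)).erase s(q, r)).erase s(r, t)).card = E.card - 3 := by
      simp at hnd
      rw [card_erase_of_mem, card_erase_of_mem, card_erase_of_mem hpq]
      · omega
      · simp; grind
      · simp; grind
    have : 3 ≤ E.card := by
      by_contra hlt
      have : E.card ≤ 2 := by omega
      have hs : ({s(p, q), s(q, r), s(r, t)} : Finset (Sym2 U)) ⊆ E := by
        simp [insert_subset_iff, *]
      have := card_le_card hs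
      rw [card_eq_three.2 ⟨_, _, _, ?_, ?_, ?_, rfl⟩] at this
      · omega
      all_goals · simp at hnd ⊢; grind
    exact ih _ (by omega) ha hb (((h.erase_edge _).erase_edge _).erase_edge _) hX (by omega) rfl
  by_cases hT : ∃ x y z, x ≠ y ∧ x ≠ z ∧ y ≠ z ∧ s(x, y) ∈ E ∧ s(y, z) ∈ E ∧ s(x, z) ∈ E
  · obtain ⟨x, y, z, hxy, hxz, hyz, exy, eyz, exz⟩ := hT
    have hx := (h _ exy).2 x (by simp)
    have hy := (h _ exy).2 y (by simp)
    have hz := (h _ exz).2 z (by simp)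
    have hEcard : (((E.erase s(x, y)).erase s(y, z)).erase s(x, z)).card + 3 = E.card := by
      rw [← card_erase_add_one exy, ← card_erase_add_one (a := s(y, z)) (s := E.erase _),
        ← card_erase_add_one (a := s(x, z)) (s := (E.erase _).erase _)]
      · simp; grind
      · simp; grind
    have hXcard : (((X.erase x).erase y).erase z).card + 3 = X.card := by
      rw [← card_erase_add_one hx, ← card_erase_add_one (a := y) (s := X.erase _),
        ← card_erase_add_one (a := z) (s := (X.erase _).erase _)]
      · simp; grind
      · simp; grind
    have hg : IsGraphOn (((X.erase x).erase y).erase z)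
        (((E.erase s(x, y)).erase s(y, z)).erase s(x, z)) := by
      -- The triangle is a whole component: an edge `tu` leaving it would give the path `tuvw`.
      have hiso : ∀ {u v w}, u ≠ v → u ≠ w → v ≠ w → s(u, v) ∈ E → s(v, w) ∈ E →
          ∀ e ∈ E, u ∈ e → e = s(u, v) ∨ e = s(u, w) := by
        intro u v w huv huw hvw euv evw e he hue
        obtain ⟨t, rfl⟩ := Sym2.mem_iff_exists.1 hue
        have := h.ne he
        by_contra hc
        refine hP ⟨t, u, v, w, ?_, Sym2.eq_swap (a := u) ▸ he, euv, evw⟩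
        simp at hc ⊢; grind
      have h' := ((h.erase_edge s(x, y)).erase_edge s(y, z)).erase_edge s(x, z)
      refine ((h'.erase_vertex (y := x) ?_).erase_vertex (y := y) ?_).erase_vertex (y := z) ?_
      · intro e he hm
        have := hiso hxy hxz hyz exy eyz e (by simp at he; tauto) hm
        simp at he; grind
      · intro e he hm
        have := hiso hyz hxy.symm hxz.symm eyz (Sym2.eq_swap (a := x) ▸ exz) e
          (by simp at he; tauto) hm
        simp at he; grind [Sym2.eq_swap (a := x) (b := y)]
      · intro e he hm
        have := hiso hxz.symm hyz.symm hxy (Sym2.eq_swap (a := x) ▸ exz) exy e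
          (by simp at he; tauto) hm
        simp at he
        grind [Sym2.eq_swap (a := x) (b := z), Sym2.eq_swap (a := y) (b := z)]
    -- If at most one vertex is left, then `E` is just the triangle, and divisibility forces exactly
    -- one.
    by_cases hsmall : (((X.erase x).erase y).erase z).card ≤ 1
    · have hE := hg.eq_empty hsmall
      rw [hE] at hEcard
      simp only [card_empty] at hEcard
      obtain ⟨w, hw⟩ := card_eq_one.1 (by omega : (((X.erase x).erase y).erase z).card = 1)
      exact pathDecomposable_triangle_add_vertex hab ha hb hx hy hz hxy hxz hyz exy eyz exz hw hE
    · exact pathDecomposable_remove_triangle hab ha hb hx hy hz hxy hxz hyz exy eyz exz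
        (ih _ (by omega) (by simp [ha]) (by simp [hb]) hg (by omega) (by omega) rfl)
  by_cases hE : E.card ≤ 1
  · exact pathDecomposable_joinEdges_of_card_le_one hab ha hb h hE hX hdvd
  -- Every edge is now pendant; `y` and `z` are leaves of two different ones.
  obtain ⟨e, he, f, hf, hef⟩ := one_lt_card.1 (by omega : 1 < E.card)
  obtain ⟨x, y, rfl, hpend⟩ := h.exists_pendant hP hT he
  obtain ⟨w, z, rfl, hpend'⟩ := h.exists_pendant hP hT hf
  have hx := (h _ he).2 x (by simp)
  have hy := (h _ he).2 y (by simp)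
  have hw := (h _ hf).2 w (by simp)
  have hz := (h _ hf).2 z (by simp)
  have hxy := h.ne he
  have hwz := h.ne hf
  have hyz : y ≠ z := by rintro rfl; exact hef (hpend _ hf (by simp)).symm
  have hyw : y ≠ w := by rintro rfl; exact hef (hpend _ hf (by simp)).symm
  have hxz : x ≠ z := by rintro rfl; exact hef (hpend' _ he (by simp))
  have hEcard : ((E.erase s(x, y)).erase s(w, z)).card + 2 = E.card := by
    rw [← card_erase_add_one he, ← card_erase_add_one (mem_erase.2 ⟨hef.symm, hf⟩)]
  have hXcard : ((X.erase y).erase z).card + 2 = X.card := by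
    rw [← card_erase_add_one hy, ← card_erase_add_one (mem_erase.2 ⟨hyz.symm, hz⟩)]
  have hg : IsGraphOn ((X.erase y).erase z) ((E.erase s(x, y)).erase s(w, z)) := by
    refine (((h.erase_edge s(x, y)).erase_edge s(w, z)).erase_vertex ?_).erase_vertex ?_
    · intro e he hm
      have := hpend e (by simp at he; tauto) hm
      simp [this] at he
    · intro e he hm
      have := hpend' e (by simp at he; tauto) hm
      simp [this] at he
  by_cases hsmall : ((X.erase y).erase z).card ≤ 1
  · have hx' : x ∈ (X.erase y).erase z := by simp [hx, hxy, hxz]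
    have hw' : w ∈ (X.erase y).erase z := by simp [hw, hwz, hyw.symm]
    obtain rfl := card_le_one.1 hsmall _ hx' _ hw'
    refine pathDecomposable_cherry hab ha hb hx hy hz hxy hyz hxz he hf ?_ (hg.eq_empty hsmall)
    exact eq_singleton_iff_unique_mem.2 ⟨hx', fun u hu => card_le_one.1 hsmall _ hu _ hx'⟩
  · exact pathDecomposable_remove_pendants ha hb hx hy hw hz hxy hwz hyz hxz hyw he hf
      (ih _ (by omega) (by simp [ha]) (by simp [hb]) hg (by omega) (by omega) rfl)

end

end PathDesign

/-! ### From edge decompositions to designs. -/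

namespace PathDesign

open Finset

variable {U : Type*}

theorem mk_mem_edgeSet_completeOn {X : Finset U} {x y : U} :
    s(x, y) ∈ (completeOn X).edgeSet ↔ x ∈ X ∧ y ∈ X ∧ x ≠ y := by
  simp [completeOn]

theorem le_completeOn_iff {X : Finset U} {B : GraphOn U} :
    B ≤ completeOn X ↔ B.verts ⊆ X := by
  refine ⟨fun h => by simpa [completeOn] using h.1, fun h => ⟨by simpa [completeOn] using h, ?_⟩⟩
  intro x y hxy
  have := mk_mem_edgeSet_completeOn (X := X) (x := x) (y := y)
  rw [SimpleGraph.Subgraph.mem_edgeSet] at this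
  exact this.2 ⟨h hxy.fst_mem, h hxy.snd_mem, hxy.ne⟩

open Classical in
/-- The edges of the complete graph on `X` as a finite set. -/
noncomputable def completeEdges (X : Finset U) : Finset (Sym2 U) :=
  X.offDiag.image Sym2.mk.uncurry

theorem mk_mem_completeEdges {X : Finset U} {x y : U} :
    s(x, y) ∈ completeEdges X ↔ x ∈ X ∧ y ∈ X ∧ x ≠ y := by
  simp only [completeEdges, mem_image, mem_offDiag, Prod.exists, Function.uncurry_apply_pair,
    Sym2.eq_iff]
  grind

theorem coe_completeEdges (X : Finset U) :
    (completeEdges X : Set (Sym2 U)) = (completeOn X).edgeSet := by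
  ext e
  induction e with
  | _ x y => rw [mem_coe, mk_mem_completeEdges, mk_mem_edgeSet_completeOn]

theorem card_completeEdges (X : Finset U) : (completeEdges X).card = X.card.choose 2 := by
  classical
  rw [← Sym2.card_image_offDiag, completeEdges]

theorem edgeSet_toSubgraph_pathGraph_four {V : Type*} {G : SimpleGraph V}
    (f : SimpleGraph.Copy (P 4) G) :
    f.toSubgraph.edgeSet = {s(f 0, f 1), s(f 1, f 2), s(f 2, f 3)} := by
  ext e
  induction e with
  | _ x y =>
    have h : ∀ i j : Fin 4, (P 4).Adj i j ↔ (i = 0 ∧ j = 1 ∨ i = 1 ∧ j = 0) ∨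
        (i = 1 ∧ j = 2 ∨ i = 2 ∧ j = 1) ∨ i = 2 ∧ j = 3 ∨ i = 3 ∧ j = 2 := by
      simp only [SimpleGraph.pathGraph_adj]
      decide
    simp only [SimpleGraph.Subgraph.mem_edgeSet, SimpleGraph.Subgraph.map_adj, Relation.Map,
      SimpleGraph.Subgraph.top_adj, h, Set.mem_insert_iff, Set.mem_singleton_iff, Sym2.eq_iff]
    constructor
    · rintro ⟨i, j, h, rfl, rfl⟩
      rcases h with (⟨rfl, rfl⟩ | ⟨rfl, rfl⟩) | (⟨rfl, rfl⟩ | ⟨rfl, rfl⟩) | ⟨rfl, rfl⟩ | ⟨rfl, rfl⟩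
        <;> simp
    · rintro ((⟨rfl, rfl⟩ | ⟨rfl, rfl⟩) | (⟨rfl, rfl⟩ | ⟨rfl, rfl⟩) | ⟨rfl, rfl⟩ | ⟨rfl, rfl⟩)
      exacts [⟨0, 1, by simp⟩, ⟨1, 0, by simp⟩, ⟨1, 2, by simp⟩, ⟨2, 1, by simp⟩,
        ⟨2, 3, by simp⟩, ⟨3, 2, by simp⟩]

theorem verts_toSubgraph_pathGraph_four {V : Type*} {G : SimpleGraph V}
    (f : SimpleGraph.Copy (P 4) G) : f.toSubgraph.verts = {f 0, f 1, f 2, f 3} := by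
  ext x
  simp [Fin.exists_fin_succ]
  grind

/-- The edge set of a path on four vertices in a complete graph. -/
theorem exists_edges_of_iso {B : GraphOn U} (h : Nonempty (B.coe ≃g P 4)) :
    ∃ S : Finset (Sym2 U), (S : Set (Sym2 U)) = B.edgeSet ∧ S.card = 3 := by
  classical
  obtain ⟨f, rfl⟩ : B ∈ Set.range (SimpleGraph.Copy.toSubgraph (A := P 4)) := by
    rw [SimpleGraph.Copy.range_toSubgraph]
    exact h.map SimpleGraph.Iso.symm
  refine ⟨{s(f 0, f 1), s(f 1, f 2), s(f 2, f 3)}, ?_, ?_⟩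
  · rw [edgeSet_toSubgraph_pathGraph_four]
    push_cast
    rfl
  · have hf : ∀ i j, f i = f j ↔ i = j := fun i j => f.injective.eq_iff
    refine card_eq_three.2 ⟨_, _, _, ?_, ?_, ?_, rfl⟩ <;> simp [hf]

theorem exists_path_subgraph {p q r t : U} (hpath : [p, q, r, t].Nodup) :
    ∃ B : GraphOn U, Nonempty (B.coe ≃g P 4) ∧ B.edgeSet = {s(p, q), s(q, r), s(r, t)} ∧
      B.verts = {p, q, r, t} := by
  have hinj : Function.Injective ![p, q, r, t] := by
    simp at hpath
    intro i j h
    fin_cases i <;> fin_cases j <;> simp at h ⊢ <;> grind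
  let f : SimpleGraph.Copy (P 4) (⊤ : SimpleGraph U) :=
    ⟨⟨![p, q, r, t], fun {i j} h => hinj.ne h.ne⟩, hinj⟩
  exact ⟨f.toSubgraph, ⟨f.isoToSubgraph.symm⟩, edgeSet_toSubgraph_pathGraph_four f,
    verts_toSubgraph_pathGraph_four f⟩

theorem exists_path_subgraph_le {W : Type*} {Γ : SimpleGraph W} (hΓ : (P 4).IsContained Γ)
    {B : GraphOn U} (hB : Nonempty (B.coe ≃g Γ)) :
    ∃ Q : GraphOn U, Q ≤ B ∧ Nonempty (Q.coe ≃g P 4) := by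
  obtain ⟨g⟩ := hΓ
  obtain ⟨φ⟩ := hB
  let f : SimpleGraph.Copy (P 4) B.coe := φ.symm.toCopy.comp g
  refine ⟨(B.coeCopy.comp f).toSubgraph, ⟨?_, ?_⟩,
    ⟨(B.coeCopy.comp f).isoToSubgraph.symm⟩⟩
  · rintro _ ⟨i, -, rfl⟩
    exact (f i).2
  · rintro _ _ ⟨i, j, hij, rfl, rfl⟩
    exact f.toHom.map_adj hij

/-- Without repeated edges the summands are disjoint, which makes the block through an edge unique.
That block vertices lie on block edges later bounds the blocks' vertex sets by way of their edges.
-/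
theorem PathDecomposable.exists_blocks {M : Multiset (Sym2 U)} (hM : PathDecomposable M)
    (hnd : M.Nodup) :
    ∃ 𝓒 : Set (GraphOn U),
      (∀ B ∈ 𝓒, Nonempty (B.coe ≃g P 4) ∧ (∀ u ∈ B.verts, ∃ e ∈ B.edgeSet, u ∈ e) ∧
        ∀ e ∈ B.edgeSet, e ∈ M) ∧
      ∀ e ∈ M, ∃! B : GraphOn U, B ∈ 𝓒 ∧ e ∈ B.edgeSet := by
  induction hM with
  | zero => exact ⟨∅, by simp, by simp⟩
  | @add_path M p q r t hpath hM ih =>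
    rw [add_assoc, add_assoc, Multiset.nodup_add] at hnd
    obtain ⟨hndM, -, hdisj⟩ := hnd
    obtain ⟨𝓒, h𝓒, huniq⟩ := ih hndM
    obtain ⟨B, hB, hedge, hverts⟩ := exists_path_subgraph hpath
    have hBM : ∀ e ∈ B.edgeSet, e ∉ M := by
      intro e he heM
      refine Multiset.disjoint_left.1 hdisj heM ?_
      simp only [hedge, Set.mem_insert_iff, Set.mem_singleton_iff] at he
      simp only [Multiset.mem_add, Multiset.mem_singleton]
      tauto
    refine ⟨insert B 𝓒, ?_, ?_⟩
    · rintro C (rfl | hC)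
      · refine ⟨hB, ?_, ?_⟩
        · intro u hu
          simp only [hverts, Set.mem_insert_iff, Set.mem_singleton_iff] at hu
          simp only [hedge, Set.mem_insert_iff, Set.mem_singleton_iff, exists_eq_or_imp,
            exists_eq_left, Sym2.mem_iff]
          tauto
        · intro e he
          simp only [hedge, Set.mem_insert_iff, Set.mem_singleton_iff] at he
          simp only [Multiset.mem_add, Multiset.mem_singleton]
          tauto
      · refine ⟨(h𝓒 C hC).1, (h𝓒 C hC).2.1, fun e he => ?_⟩
        simp [(h𝓒 C hC).2.2 e he]
    · intro e he
      by_cases heB : e ∈ B.edgeSet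
      · refine ⟨B, ⟨Set.mem_insert _ _, heB⟩, ?_⟩
        rintro C ⟨rfl | hC, heC⟩
        · rfl
        · exact absurd ((h𝓒 C hC).2.2 e heC) (hBM e heB)
      · have heM : e ∈ M := by
          simp only [hedge, Set.mem_insert_iff, Set.mem_singleton_iff] at heB
          simp only [Multiset.mem_add, Multiset.mem_singleton] at he
          tauto
        obtain ⟨C, ⟨hC, heC⟩, hCu⟩ := huniq e heM
        refine ⟨C, ⟨Set.mem_insert_of_mem _ hC, heC⟩, ?_⟩
        rintro D ⟨rfl | hD, heD⟩
        · exact absurd heD heB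
        · exact hCu D ⟨hD, heD⟩

theorem joinEdges_nodup {a b : U} {X : Finset U} {E : Finset (Sym2 U)} (hab : a ≠ b)
    (ha : a ∉ X) (hb : b ∉ X) (h : IsGraphOn X E) : (joinEdges a b X E).Nodup := by
  have hinj : ∀ c : U, Function.Injective fun x : U => s(c, x) := fun c x y hxy =>
    Sym2.congr_right.1 hxy
  have hc : ∀ {c x : U}, c ∉ X → s(c, x) ∉ E := fun hc he => hc ((h _ he).2 _ (by simp))
  simp only [joinEdges, Multiset.nodup_add, Multiset.disjoint_left, Multiset.mem_add,
    Multiset.mem_map, mem_val, Multiset.mem_singleton, Multiset.nodup_singleton]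
  refine ⟨⟨⟨E.nodup, X.nodup.map (hinj a), ?_⟩, X.nodup.map (hinj b), ?_⟩, trivial, ?_⟩
  · rintro e he ⟨x, -, rfl⟩
    exact hc ha he
  · rintro e (he | ⟨x, hx, rfl⟩) ⟨y, hy, hxy⟩
    · exact hc hb (hxy ▸ he)
    · simp at hxy; grind
  · rintro e ((he | ⟨x, hx, rfl⟩) | ⟨x, hx, rfl⟩) hxy
    · exact hc ha (hxy ▸ he)
    · simp at hxy; grind
    · simp at hxy; grind

theorem mem_joinEdges_iff {a b : U} {X Y : Finset U} {E : Finset (Sym2 U)} (hab : a ≠ b)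
    (hYX : ∀ u, u ∈ Y ↔ u = a ∨ u = b ∨ u ∈ X) (ha : a ∉ X) (hb : b ∉ X)
    (S : Finset (Sym2 U)) (hS : S ⊆ completeEdges X)
    (hE : ∀ e, e ∈ E ↔ e ∈ completeEdges X ∧ e ∉ S) {e : Sym2 U} :
    e ∈ joinEdges a b X E ↔ e ∈ completeEdges Y ∧ e ∉ S := by
  induction e with
  | _ x y =>
    have hS' : s(x, y) ∈ S → x ∈ X ∧ y ∈ X := fun h => by
      have := mk_mem_completeEdges.1 (hS h); tauto
    simp only [joinEdges, Multiset.mem_add, Multiset.mem_map, mem_val, Multiset.mem_singleton, hE,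
      mk_mem_completeEdges, hYX, Sym2.eq_iff]
    grind

theorem three_dvd_choose_two {n : ℕ} (h : n ≡ 0 [MOD 3] ∨ n ≡ 1 [MOD 3]) :
    3 ∣ n.choose 2 := by
  have h2 : 3 ∣ n * (n - 1) := by
    rcases h with h | h
    · exact Dvd.dvd.mul_right ((Nat.modEq_zero_iff_dvd).1 h) _
    · refine Dvd.dvd.mul_left ?_ _
      unfold Nat.ModEq at h
      omega
  rw [Nat.choose_two_right]
  have := Nat.div_mul_cancel (Nat.even_mul_pred_self n).two_dvd
  omega

/-- A family of edge-disjoint paths on four vertices in a complete graph extends to a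
`P 4`-design of any admissible order exceeding that of the complete graph by at least two. -/
theorem exists_design_of_edge_disjoint [Infinite U] {X : Finset U} {ι : Type*} (Q : ι → GraphOn U)
    (hX : ∀ i, Q i ≤ completeOn X) (hQ : ∀ i, Nonempty ((Q i).coe ≃g P 4))
    (hdisj : ∀ i j, ∀ e ∈ (Q i).edgeSet, e ∈ (Q j).edgeSet → i = j)
    {n : ℕ} (hv : 2 ≤ X.card) (hn : X.card + 2 ≤ n) (hmod : n ≡ 0 [MOD 3] ∨ n ≡ 1 [MOD 3]) :
    ∃ 𝓑 : Set (GraphOn U), IsDesignOfOrder (P 4) n 𝓑 ∧ ∀ i, Q i ∈ 𝓑 := by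
  classical
  obtain ⟨Z, hXZ, hZ⟩ := Infinite.exists_superset_card_eq X (n - 2) (by omega)
  obtain ⟨Y, hZY, hY⟩ := Infinite.exists_superset_card_eq Z n (by omega)
  obtain ⟨a, b, hab, hYZ⟩ := card_eq_two.1
    (by rw [card_sdiff_of_subset hZY]; omega : (Y \ Z).card = 2)
  have hmem : ∀ u, u ∈ Y \ Z ↔ u = a ∨ u = b := by simp [hYZ]
  simp only [mem_sdiff] at hmem
  have ha : a ∉ Z := ((hmem a).2 (Or.inl rfl)).2
  have hb : b ∉ Z := ((hmem b).2 (Or.inr rfl)).2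
  have hY' : ∀ u, u ∈ Y ↔ u = a ∨ u = b ∨ u ∈ Z := by
    intro u
    have := hmem u
    have := @hZY u
    tauto
  choose S hS hS3 using fun i => exists_edges_of_iso (hQ i)
  have hmemS : ∀ {i e}, e ∈ S i ↔ e ∈ (Q i).edgeSet := fun {i e} => by rw [← hS, mem_coe]
  have hQZ : ∀ i, Q i ≤ completeOn Z := fun i =>
    le_completeOn_iff.2 ((le_completeOn_iff.1 (hX i)).trans (by exact_mod_cast hXZ))
  have hSZ : ∀ i, S i ⊆ completeEdges Z := fun i e he => by
    rw [← mem_coe, coe_completeEdges]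
    exact SimpleGraph.Subgraph.edgeSet_mono (hQZ i) (hmemS.1 he)
  -- Disjoint nonempty edge sets inside a finite set: there are only finitely many paths.
  have hfin : Finite ι := by
    refine Finite.of_injective
      (fun i => (⟨S i, mem_powerset.2 (hSZ i)⟩ : (completeEdges Z).powerset)) fun i j hij => ?_
    have hij : S i = S j := by simpa using hij
    obtain ⟨e, he⟩ := card_pos.1 (by rw [hS3 i]; omega : 0 < (S i).card)
    exact hdisj i j e (hmemS.1 he) (hmemS.1 (hij ▸ he))
  have := Fintype.ofFinite ι
  set T : Finset (Sym2 U) := univ.biUnion S with hT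
  have hTZ : T ⊆ completeEdges Z := biUnion_subset.2 fun i _ => hSZ i
  have hTcard : T.card = Fintype.card ι * 3 := by
    rw [hT, card_biUnion, sum_congr rfl fun i _ => hS3 i, sum_const, card_univ, smul_eq_mul]
    intro i _ j _ hij
    exact disjoint_left.2 fun e hi hj => hij (hdisj i j e (hmemS.1 hi) (hmemS.1 hj))
  have hEcard : (completeEdges Z \ T).card + Fintype.card ι * 3 = (n - 2).choose 2 := by
    rw [← hTcard, card_sdiff_add_card_eq_card hTZ, card_completeEdges, hZ]
  have hgraph : IsGraphOn Z (completeEdges Z \ T) := by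
    intro e he
    induction e with
    | _ x y =>
      have := mk_mem_completeEdges.1 (mem_sdiff.1 he).1
      simp only [Sym2.mk_isDiag_iff, Sym2.mem_iff]
      grind
  -- The sum is the number of edges of `K_n` minus 3 for each chosen path.
  have hdvd : 3 ∣ (completeEdges Z \ T).card + 2 * Z.card + 1 := by
    have h3 := three_dvd_choose_two hmod
    obtain ⟨m, rfl⟩ : ∃ m, n = m + 2 := ⟨n - 2, by omega⟩
    have h4 : (m + 2).choose 2 = m.choose 2 + 2 * m + 1 := by
      simp [Nat.choose_succ_succ' _ 1]; omega
    simp only [Nat.add_sub_cancel] at hEcard hZ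
    omega
  obtain ⟨𝓒, h𝓒, huniq⟩ := (pathDecomposable_joinEdges hab ha hb hgraph
    (by omega) hdvd).exists_blocks (joinEdges_nodup hab ha hb hgraph)
  have hjoin : ∀ {e}, e ∈ joinEdges a b Z (completeEdges Z \ T) ↔ e ∈ completeEdges Y ∧ e ∉ T :=
    mem_joinEdges_iff hab hY' ha hb T hTZ fun e => mem_sdiff
  have hmemT : ∀ {e}, e ∈ T ↔ ∃ i, e ∈ (Q i).edgeSet := by simp [hT, hmemS]
  refine ⟨Set.range Q ∪ 𝓒, ⟨Y, hY, ?_, ?_, ?_⟩, fun i => Or.inl ⟨i, rfl⟩⟩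
  · rintro B (⟨i, rfl⟩ | hB)
    · exact le_completeOn_iff.2 ((le_completeOn_iff.1 (hQZ i)).trans (by exact_mod_cast hZY))
    · refine le_completeOn_iff.2 fun u hu => ?_
      obtain ⟨e, he, hue⟩ := (h𝓒 B hB).2.1 u hu
      have he' := (hjoin.1 ((h𝓒 B hB).2.2 e he)).1
      obtain ⟨w, rfl⟩ := Sym2.mem_iff_exists.1 hue
      exact (mk_mem_completeEdges.1 he').1
  · rintro B (⟨i, rfl⟩ | hB)
    · exact hQ i
    · exact (h𝓒 B hB).1
  · intro e he
    rw [← coe_completeEdges, mem_coe] at he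
    by_cases heT : e ∈ T
    · obtain ⟨i, hi⟩ := hmemT.1 heT
      refine ⟨Q i, ⟨Or.inl ⟨i, rfl⟩, hi⟩, ?_⟩
      rintro C ⟨⟨j, rfl⟩ | hC, heC⟩
      · rw [hdisj i j e hi heC]
      · exact absurd heT (hjoin.1 ((h𝓒 C hC).2.2 e heC)).2
    · obtain ⟨C, ⟨hC, heC⟩, hCu⟩ := huniq e (hjoin.2 ⟨he, heT⟩)
      refine ⟨C, ⟨Or.inr hC, heC⟩, ?_⟩
      rintro D ⟨⟨j, rfl⟩ | hD, heD⟩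
      · exact absurd (hmemT.2 ⟨j, heD⟩) heT
      · exact hCu D ⟨hD, heD⟩

end PathDesign

theorem corollary3p2 {U : Type*} [Infinite U] {W : Type*} (Γ : SimpleGraph W)
    (hΓ : (PathDesign.P 4).IsContained Γ) (v : ℕ) (hv : 1 < v)
    (hadm : ∃ 𝓑 : Set (PathDesign.GraphOn U), PathDesign.IsDesignOfOrder Γ v 𝓑) :
    {n : ℕ | v + 2 ≤ n ∧ (n ≡ 0 [MOD 3] ∨ n ≡ 1 [MOD 3])} ⊆
        PathDesign.L2 U (PathDesign.P 4) Γ v ∧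
      PathDesign.L2 U (PathDesign.P 4) Γ v ⊆ PathDesign.L1 U (PathDesign.P 4) Γ v := by
  refine ⟨?_, fun n hn => hadm.imp fun 𝓑 h𝓑 => ⟨h𝓑, hn 𝓑 h𝓑⟩⟩
  rintro n ⟨hn, hmod⟩ 𝓑 ⟨X, rfl, h𝓑⟩
  choose Q hQB hQ using fun B : 𝓑 => PathDesign.exists_path_subgraph_le hΓ (h𝓑.iso B B.2)
  have hdisj : ∀ B C, ∀ e ∈ (Q B).edgeSet, e ∈ (Q C).edgeSet → B = C := by
    intro B C e hB hC
    have heB := SimpleGraph.Subgraph.edgeSet_mono (hQB B) hB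
    have heC := SimpleGraph.Subgraph.edgeSet_mono (hQB C) hC
    have heX := SimpleGraph.Subgraph.edgeSet_mono (h𝓑.le B B.2) heB
    exact Subtype.ext ((h𝓑.partition e heX).unique ⟨B.2, heB⟩ ⟨C.2, heC⟩)
  obtain ⟨𝓑', h𝓑', hmem⟩ := PathDesign.exists_design_of_edge_disjoint Q
    (fun B => (hQB B).trans (h𝓑.le B B.2)) hQ hdisj hv hn hmod
  exact ⟨𝓑', h𝓑', fun B => ⟨Q B, hmem B⟩, hQB⟩
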